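/- Let $n\ge 1$, let $\Delta\subset\mathbb R^n$ be an open standard $n$-simplex, that is, the interior of a regular $n$-simplex inscribed in the unit sphere centred at the origin, let $k\ge 2$ be an integer and let $p>\frac{n-1}{k-1}$ be real. Let $\Omega^k_p(\Delta)$ be the space of (classes modulo equality almost everywhere of) measurable differential $k$-forms on $\Delta$ with finite norm $$\|\omega\|_{\Omega^k_p(\Delta)}=\Big(\int_\Delta|\omega(x)|^p\,dx\Big)^{1/p},$$ where $|\cdot|$ is the Euclidean norm on exterior forms for which the monomials $dx_{j_1}\wedge\dots\wedge dx_{j_k}$, $j_1<\dots<j_k$, are orthonormal. Let $S$ be the homotopy operator $$S\omega(x)\langle\xi_1,\dots,\xi_{k-1}\rangle=\int_0^1 t^{k-1}\,\omega(tx)\langle x,\xi_1,\dots,\xi_{k-1}\rangle\,dt .$$ Then for every $\omega\in\Omega^k_p(\Delta)$ the integral defining $S\omega(x)$ converges absolutely for almost every $x\in\Delta$, $S\omega$ does not depend (up to equality almost everywhere) on the representative of $\omega$, $S\omega\in\Omega^{k-1}_p(\Delta)$, and $$\|S\omega\|_{\Omega^{k-1}_p(\Delta)}\le\frac{\sqrt{\binom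 nk}\,(n-k+1)}{n^2\,(p(k-1)-n+1)^{1/p}}\left(\frac{n!^{\frac{p+1}p}}{(n-k+1)!}\right)^{2}\|\omega\|_{\Omega^k_p(\Delta)} .$$ (For $k>n$ every $k$-form is zero, $\binom nk=0$, and the right-hand side is read as $0$.) -/

import Mathlib

open MeasureTheory
open scoped ENNReal

noncomputable section

/-- Exterior `k`-forms on `ℝⁿ`: alternating `k`-linear functionals. A differential `k`-form is a
function with values in this space. -/
abbrev ExtForm (n k : ℕ) : Type :=
  EuclideanSpace ℝ (Fin n) [⋀^Fin k]→L[ℝ] ℝ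

/-- The coefficient of `dx_{J 0} ∧ ⋯ ∧ dx_{J (k-1)}` in an exterior `k`-form, for an increasing
multi-index `J`. -/
def ExtForm.coeff {n k : ℕ} (α : ExtForm n k) (J : Fin k ↪o Fin n) : ℝ :=
  α fun i => EuclideanSpace.basisFun (Fin n) ℝ (J i)

/-- The Euclidean length of an exterior form, for which the monomials
`dx_{J 0} ∧ ⋯ ∧ dx_{J (k-1)}` with `J` increasing are orthonormal. (The norm that Mathlib puts on
alternating maps is the operator norm; here it serves only for its topology.) -/
def ExtForm.length {n k : ℕ} (α : ExtForm n k) : ℝ :=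
  Real.sqrt (∑ J : Fin k ↪o Fin n, α.coeff J ^ 2)

/-- The `L^p` norm `(∫_D |ω(x)|^p dx)^{1/p}` of a differential form, with values in `[0, ∞]`. -/
def formLpNorm {n k : ℕ} (p : ℝ) (D : Set (EuclideanSpace ℝ (Fin n)))
    (ω : EuclideanSpace ℝ (Fin n) → ExtForm n k) : ℝ≥0∞ :=
  eLpNorm (fun x => (ω x).length) (ENNReal.ofReal p) (volume.restrict D)

/-- `ω` represents an element of `Ω^k_p(D)`: it is measurable on `D` (up to a null set) and has
finite `L^p` norm. -/
def MemFormLp {n k : ℕ} (p : ℝ) (D : Set (EuclideanSpace ℝ (Fin n)))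
    (ω : EuclideanSpace ℝ (Fin n) → ExtForm n k) : Prop :=
  AEStronglyMeasurable ω (volume.restrict D) ∧ formLpNorm p D ω < ∞

/-- The contraction `α⟨v, ξ₁, …, ξ_{k-1}⟩` of a `k`-form with a vector (zero if `k = 0`). -/
def ExtForm.contract {n : ℕ} : {k : ℕ} → EuclideanSpace ℝ (Fin n) → ExtForm n k →
    ExtForm n (k - 1)
  | 0, _, _ => 0
  | _ + 1, v, α => α.curryLeft v

/-- The integrand `t^{k-1} ω(tx)⟨x, ·, …, ·⟩` of the homotopy operator. -/
def homotopyIntegrand {n k : ℕ} (ω : EuclideanSpace ℝ (Fin n) → ExtForm n k)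
    (x : EuclideanSpace ℝ (Fin n)) (t : ℝ) : ExtForm n (k - 1) :=
  t ^ (k - 1) • ExtForm.contract x (ω (t • x))

/-- The homotopy operator `Sω(x) = ∫₀¹ t^{k-1} ω(tx)⟨x, ·, …, ·⟩ dt`. -/
def homotopyOp {n k : ℕ} (ω : EuclideanSpace ℝ (Fin n) → ExtForm n k)
    (x : EuclideanSpace ℝ (Fin n)) : ExtForm n (k - 1) :=
  ∫ t in (0 : ℝ)..1, homotopyIntegrand ω x t

/-- The simplex is the standard one: regular and inscribed in the unit sphere centred at the
origin. -/
def IsStandardSimplex {n : ℕ} (s : Affine.Simplex ℝ (EuclideanSpace ℝ (Fin n)) n) : Prop :=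
  s.Equilateral ∧ s.circumcenter = 0 ∧ s.circumradius = 1

end

/-! The barycentre of the simplex is the origin and its vertices are unit vectors, so it is
star-shaped about 0 and lies in the unit ball. Contraction with x is bounded by |x| ≤ 1 in the
Euclidean length (extend x/|x| to an orthonormal basis), hence |Sω(x)| is at most the ray average
∫₀¹ t^(k-1)|ω(tx)| dt.

If k ≤ n, the hypothesis forces p ≥ 1. Jensen on [0,1], Tonelli and the substitution y = tx then
bound the p-th power of the norm of this average by ∫₀¹ t^(p(k-1)-n) dt · ‖ω‖^p = ‖ω‖^p /
(p(k-1)-n+1); the condition on p is exactly convergence of this integral. The average is therefore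
finite almost everywhere, which gives absolute convergence. The resulting constant
(p(k-1)-n+1)^(-1/p) is no larger than the stated one (`rpow_neg_le_homotopy_constant`). If k > n,
all forms vanish.

The analytic core is `lintegral_rpow_lintegral_smul_le`, the algebraic one
`ExtForm.length_contract_le`. -/

/-! ### Euclidean length of exterior forms and contraction -/

/-- The squared length of an alternating map counts every increasing multi-index `k!` times. -/
theorem ContinuousAlternatingMap.sum_sq_apply_comp {E : Type*} [AddCommGroup E] [Module ℝ E]
    [TopologicalSpace E] {n k : ℕ} (α : E [⋀^Fin k]→L[ℝ] ℝ) (b : Fin n → E) :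
    ∑ f : Fin k → Fin n, α (b ∘ f) ^ 2 =
      (k.factorial : ℝ) * ∑ J : Fin k ↪o Fin n, α (b ∘ J) ^ 2 := by
  have hperm : ∀ (J : Fin k ↪o Fin n) (σ : Equiv.Perm (Fin k)),
      α (b ∘ J ∘ σ) ^ 2 = α (b ∘ J) ^ 2 := by
    intro J σ
    have h := α.toAlternatingMap.map_perm (b ∘ J) σ
    rcases Int.units_eq_one_or (Equiv.Perm.sign σ) with hs | hs <;> rw [hs] at h
    · have h' : α (b ∘ J ∘ σ) = α (b ∘ J) := by simpa [Function.comp_assoc] using h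
      rw [h']
    · have h' : α (b ∘ J ∘ σ) = -α (b ∘ J) := by simpa [Function.comp_assoc] using h
      rw [h', neg_sq]
  -- Injective tuples factor uniquely as J ∘ σ with J increasing; α vanishes on the other tuples.
  have h := Finset.sum_of_injOn
    (fun q : (Fin k ↪o Fin n) × Equiv.Perm (Fin k) => (q.1 ∘ q.2 : Fin k → Fin n))
    (s := Finset.univ) (t := Finset.univ)
    (f := fun q => α (b ∘ q.1) ^ 2) (g := fun f => α (b ∘ f) ^ 2)
    (fun q _ q' _ hqq => by
      obtain ⟨J, σ⟩ := q
      obtain ⟨J', σ'⟩ := q'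
      simp only at hqq
      have hr : Set.range J = Set.range J' := by
        rw [← σ.surjective.range_comp J, ← σ'.surjective.range_comp J', hqq]
      have hJ : J = J' := by
        ext i : 1
        exact congrFun (StrictMono.range_inj J.strictMono J'.strictMono |>.1 hr) i
      subst hJ
      have : σ = σ' := by
        ext i : 1
        exact J.injective (congrFun hqq i)
      rw [this])
    (fun _ _ => Finset.mem_coe.2 (Finset.mem_univ _))
    (fun f _ hf => by
      have hinj : ¬ Function.Injective f := by
        intro hinj
        refine hf ⟨(OrderEmbedding.ofStrictMono (f ∘ Tuple.sort f)
          ((Tuple.monotone_sort f).strictMono_of_injective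
            (hinj.comp (Tuple.sort f).injective)), (Tuple.sort f).symm), by simp, ?_⟩
        ext i
        simp
      have h0 : α (b ∘ f) = 0 := by
        simp only [Function.Injective, not_forall] at hinj
        obtain ⟨i, j, hij, hne⟩ := hinj
        exact α.map_eq_zero_of_eq _ (congrArg b hij) hne
      simp [h0])
    (fun q _ => (hperm q.1 q.2).symm)
  rw [← h, Fintype.sum_prod_type, Finset.mul_sum]
  simp [Fintype.card_perm]

/-- Both sums are the squared norm of the Riesz vector of l. -/
theorem OrthonormalBasis.sum_sq_apply_eq {E ι κ : Type*} [NormedAddCommGroup E]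
    [InnerProductSpace ℝ E] [Fintype ι] [Fintype κ] (b : OrthonormalBasis ι ℝ E)
    (e : OrthonormalBasis κ ℝ E) (l : E →ₗ[ℝ] ℝ) :
    ∑ i, l (b i) ^ 2 = ∑ j, l (e j) ^ 2 := by
  have : FiniteDimensional ℝ E := b.toBasis.finiteDimensional_of_finite
  obtain ⟨y, hy⟩ := (InnerProductSpace.toDual ℝ E).surjective (LinearMap.toContinuousLinearMap l)
  have hl : ∀ v, l v = inner ℝ y v := fun v => by
    rw [← InnerProductSpace.toDual_apply_apply (𝕜 := ℝ), hy]; rfl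
  simpa [hl] using (b.sum_sq_norm_inner_left y).trans (e.sum_sq_norm_inner_left y).symm

/-- The Hilbert–Schmidt norm of a multilinear map does not depend on the orthonormal basis. -/
theorem OrthonormalBasis.sum_sq_apply_comp_eq {E ι : Type*} [NormedAddCommGroup E]
    [InnerProductSpace ℝ E] [Fintype ι] (b e : OrthonormalBasis ι ℝ E) {k : ℕ}
    (M : MultilinearMap ℝ (fun _ : Fin k => E) ℝ) :
    ∑ f : Fin k → ι, M (b ∘ f) ^ 2 = ∑ f : Fin k → ι, M (e ∘ f) ^ 2 := by
  induction k with
  | zero => simp [Subsingleton.elim (b ∘ _) (e ∘ (default : Fin 0 → ι))]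
  | succ k ih =>
    have hsplit : ∀ c : OrthonormalBasis ι ℝ E, ∑ f : Fin (k + 1) → ι, M (c ∘ f) ^ 2 =
        ∑ i, ∑ g : Fin k → ι, M.curryLeft (c i) (c ∘ g) ^ 2 := fun c => by
      rw [← (Fin.consEquiv fun _ => ι).sum_comp, Fintype.sum_prod_type]
      refine Finset.sum_congr rfl fun i _ => Finset.sum_congr rfl fun g _ => ?_
      rw [MultilinearMap.curryLeft_apply]
      congr 2
      ext j
      refine Fin.cases ?_ (fun j => ?_) j <;> simp [Fin.consEquiv]
    rw [hsplit, hsplit]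
    -- The last k slots change basis by induction with the first frozen; then the first slot changes
    -- by the linear case.
    calc ∑ i, ∑ g : Fin k → ι, M.curryLeft (b i) (b ∘ g) ^ 2
        = ∑ i, ∑ g : Fin k → ι, M.curryLeft (b i) (e ∘ g) ^ 2 :=
          Finset.sum_congr rfl fun i _ => ih _
      _ = ∑ g : Fin k → ι, ∑ i, M.curryLeft (b i) (e ∘ g) ^ 2 := Finset.sum_comm
      _ = ∑ g : Fin k → ι, ∑ i, M.curryLeft (e i) (e ∘ g) ^ 2 :=
          Finset.sum_congr rfl fun g _ => by
            let l : E →ₗ[ℝ] ℝ :=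
              { toFun := fun v => M.curryLeft v (e ∘ g)
                map_add' := fun v w => by simp
                map_smul' := fun r v => by simp }
            exact b.sum_sq_apply_eq e l
      _ = _ := Finset.sum_comm

namespace ExtForm

theorem length_nonneg {n k : ℕ} (α : ExtForm n k) : 0 ≤ α.length := Real.sqrt_nonneg _

theorem length_sq {n k : ℕ} (α : ExtForm n k) :
    α.length ^ 2 = ∑ J : Fin k ↪o Fin n, α.coeff J ^ 2 :=
  Real.sq_sqrt (Finset.sum_nonneg fun _ _ => sq_nonneg _)

/-- The length of an exterior form may be computed in any orthonormal basis. -/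
theorem length_sq_eq_sum {n k : ℕ} (α : ExtForm n k)
    (b : OrthonormalBasis (Fin n) ℝ (EuclideanSpace ℝ (Fin n))) :
    α.length ^ 2 = ∑ J : Fin k ↪o Fin n, α (b ∘ J) ^ 2 := by
  have hk : (k.factorial : ℝ) ≠ 0 := Nat.cast_ne_zero.2 k.factorial_ne_zero
  have h := b.sum_sq_apply_comp_eq (EuclideanSpace.basisFun (Fin n) ℝ) α.toMultilinearMap
  refine mul_left_cancel₀ hk ?_
  rw [length_sq, ← α.sum_sq_apply_comp b]
  exact (α.sum_sq_apply_comp _).symm.trans h.symm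

/-- A term on the left vanishes if J takes the value 0; otherwise prepending 0 gives an increasing
index, so the left side is the part of the right side with J 0 = 0. -/
theorem sum_sq_apply_cons_le {n m : ℕ} (α : ExtForm (n + 1) (m + 1))
    (b : Fin (n + 1) → EuclideanSpace ℝ (Fin (n + 1))) :
    ∑ J : Fin m ↪o Fin (n + 1), α (Fin.cons (b 0) (b ∘ J)) ^ 2 ≤
      ∑ J : Fin (m + 1) ↪o Fin (n + 1), α (b ∘ J) ^ 2 := by
  classical
  have hcons : ∀ J : Fin (m + 1) ↪o Fin (n + 1), J 0 = 0 →
      Fin.cons (b 0) (b ∘ (Fin.succOrderEmb m).trans J) = b ∘ J := fun J hJ => by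
    ext1 j
    refine Fin.cases ?_ (fun j => ?_) j <;> simp [hJ]
  have h := Finset.sum_of_injOn
    (fun J : Fin (m + 1) ↪o Fin (n + 1) => ((Fin.succOrderEmb m).trans J : Fin m ↪o Fin (n + 1)))
    (s := Finset.univ.filter fun J : Fin (m + 1) ↪o Fin (n + 1) => J 0 = 0) (t := Finset.univ)
    (f := fun J : Fin (m + 1) ↪o Fin (n + 1) => α (b ∘ J) ^ 2)
    (g := fun J : Fin m ↪o Fin (n + 1) => α (Fin.cons (b 0) (b ∘ J)) ^ 2)
    (fun J hJ J' hJ' h => by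
      simp only [Finset.coe_filter, Finset.mem_univ, true_and, Set.mem_ofPred_eq] at hJ hJ'
      ext1 j
      refine Fin.cases (hJ.trans hJ'.symm) (fun j => ?_) j
      exact DFunLike.congr_fun h j)
    (fun _ _ => Finset.mem_coe.2 (Finset.mem_univ _))
    (fun J _ hJ => by
      have h0 : ∃ i, J i = 0 := by
        by_contra! hne
        have hmono : StrictMono (Fin.cons 0 J : Fin (m + 1) → Fin (n + 1)) := by
          intro i j
          refine Fin.cases (Fin.cases (fun h => absurd h (lt_irrefl _)) (fun j _ => ?_) j)
            (fun i => Fin.cases (fun h => absurd h (by simp)) (fun j h => ?_) j) i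
          · simpa using Fin.pos_iff_ne_zero.2 (hne j)
          · simpa using h
        exact hJ ⟨OrderEmbedding.ofStrictMono _ hmono, by simp, by ext1 j; simp⟩
      obtain ⟨i, hi⟩ := h0
      have : α (Fin.cons (b 0) (b ∘ J)) = 0 :=
        α.map_eq_zero_of_eq _ (i := 0) (j := i.succ) (by simp [hi]) (Fin.succ_ne_zero i).symm
      simp [this])
    (fun J hJ => by rw [hcons J (by simpa using hJ)])
  rw [← h]
  exact Finset.sum_le_sum_of_subset_of_nonneg (Finset.filter_subset _ _)
    fun _ _ _ => sq_nonneg _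

/-- Contraction with a vector is bounded by the Euclidean norm of the vector. -/
theorem length_contract_le {n k : ℕ} (x : EuclideanSpace ℝ (Fin n)) (α : ExtForm n k) :
    (contract x α).length ≤ ‖x‖ * α.length := by
  rcases k with _ | m
  · have : (contract x α).length = 0 := by simp [contract, length, coeff]
    rw [this]
    exact mul_nonneg (norm_nonneg _) (length_nonneg _)
  rcases eq_or_ne x 0 with rfl | hx
  · simp [contract, length, coeff]
  rcases n with _ | n
  · exact absurd (Subsingleton.elim x 0) hx
  have hx' : ‖x‖ ≠ 0 := norm_ne_zero_iff.2 hx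
  -- In a basis whose first vector is x/|x|, contraction with x just fills the first slot with b 0
  -- and scales by |x|.
  obtain ⟨b, hb⟩ := Orthonormal.exists_orthonormalBasis_extension_of_card_eq (𝕜 := ℝ)
    (E := EuclideanSpace ℝ (Fin (n + 1))) (ι := Fin (n + 1)) (by simp)
    (v := fun _ => ‖x‖⁻¹ • x) (s := {0}) (by
      refine ⟨fun i => ?_, fun i j hij => absurd (Subsingleton.elim i j) hij⟩
      simp [norm_smul, hx'])
  have hb0 : x = ‖x‖ • b 0 := by
    rw [hb 0 rfl, smul_smul, mul_inv_cancel₀ hx', one_smul]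
  refine abs_le_of_sq_le_sq' ?_ (mul_nonneg (norm_nonneg _) (length_nonneg _)) |>.2
  have hJ : ∀ J : Fin m ↪o Fin (n + 1), contract x α (b ∘ J) =
      ‖x‖ * α (Fin.cons (b 0) (b ∘ J)) := fun J => by
    conv_lhs => rw [hb0]
    change α.curryLeft (‖x‖ • b 0) (b ∘ J) = _
    rw [map_smul]
    simp [Matrix.vecCons]
  rw [length_sq_eq_sum _ b, mul_pow, length_sq_eq_sum α b]
  calc ∑ J : Fin m ↪o Fin (n + 1), contract x α (b ∘ J) ^ 2
      = ‖x‖ ^ 2 * ∑ J : Fin m ↪o Fin (n + 1), α (Fin.cons (b 0) (b ∘ J)) ^ 2 := by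
        rw [Finset.mul_sum]
        exact Finset.sum_congr rfl fun J _ => by rw [hJ, mul_pow]
    _ ≤ _ := mul_le_mul_of_nonneg_left (sum_sq_apply_cons_le α b) (sq_nonneg _)

end ExtForm

/-! ### Geometry of the standard simplex -/

namespace Affine.Simplex

theorem affineSpan_range_points_eq_top {n : ℕ}
    (s : Affine.Simplex ℝ (EuclideanSpace ℝ (Fin n)) n) :
    affineSpan ℝ (Set.range s.points) = ⊤ := by
  rw [s.independent.affineSpan_eq_top_iff_card_eq_finrank_add_one]
  simp

theorem isOpen_interior {n : ℕ} (s : Affine.Simplex ℝ (EuclideanSpace ℝ (Fin n)) n) :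
    IsOpen s.interior := by
  let b : AffineBasis (Fin (n + 1)) ℝ (EuclideanSpace ℝ (Fin n)) :=
    ⟨s.points, s.independent, s.affineSpan_range_points_eq_top⟩
  have h : s.interior = ⋂ i, b.coord i ⁻¹' Set.Ioo 0 1 := by
    ext x
    have hx : Finset.univ.affineCombination ℝ s.points (fun i => b.coord i x) = x :=
      b.affineCombination_coord_eq_self x
    conv_lhs => rw [← hx]
    rw [affineCombination_mem_interior_iff (b.sum_coord_apply_eq_one x)]
    simp
  rw [h]
  exact isOpen_iInter_of_finite fun i => isOpen_Ioo.preimage (continuous_barycentric_coord b i)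

end Affine.Simplex

namespace IsStandardSimplex

variable {n : ℕ} {s : Affine.Simplex ℝ (EuclideanSpace ℝ (Fin n)) n}

theorem norm_points (hs : IsStandardSimplex s) (i : Fin (n + 1)) : ‖s.points i‖ = 1 := by
  have h := s.dist_circumcenter_eq_circumradius i
  rwa [hs.2.1, hs.2.2, dist_zero_right] at h

/-- All vertices have the same inner product with the vertex sum, so the sum is orthogonal to every
edge vector; these span the space. -/
theorem sum_points_eq_zero (hs : IsStandardSimplex s) : ∑ i, s.points i = 0 := by
  obtain ⟨d, hd⟩ := hs.1
  have hinner : ∀ i j, i ≠ j → inner ℝ (s.points i) (s.points j) = 1 - d ^ 2 / 2 := by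
    intro i j hij
    have h := norm_sub_sq_real (s.points i) (s.points j)
    rw [← dist_eq_norm, hd i j hij, hs.norm_points, hs.norm_points] at h
    linarith
  have hconst : ∀ i, inner ℝ (s.points i) (∑ j, s.points j) = 1 + n * (1 - d ^ 2 / 2) := by
    intro i
    rw [inner_sum, ← Finset.add_sum_erase _ _ (Finset.mem_univ i),
      Finset.sum_congr rfl fun j hj => hinner i j (Finset.ne_of_mem_erase hj).symm]
    simp [hs.norm_points, Finset.card_erase_of_mem]
    ring
  have hspan : Submodule.span ℝ (Set.range fun i => s.points i -ᵥ s.points 0) = ⊤ := by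
    rw [← vectorSpan_range_eq_span_range_vsub_right, ← direction_affineSpan,
      s.affineSpan_range_points_eq_top, AffineSubspace.direction_top]
  have hmem : (∑ j, s.points j) ∈
      (Submodule.span ℝ (Set.range fun i => s.points i -ᵥ s.points 0))ᗮ := by
    rw [Submodule.mem_orthogonal]
    intro u hu
    induction hu using Submodule.span_induction with
    | mem u hu =>
      obtain ⟨i, rfl⟩ := hu
      simp only [vsub_eq_sub]
      rw [inner_sub_left, hconst, hconst, sub_self]
    | zero => simp
    | add u v _ _ hu hv => rw [inner_add_left, hu, hv, add_zero]
    | smul r u _ hu => rw [inner_smul_left, hu, mul_zero]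
  rwa [hspan, Submodule.top_orthogonal_eq_bot, Submodule.mem_bot] at hmem

theorem norm_le_one (hs : IsStandardSimplex s) {x : EuclideanSpace ℝ (Fin n)}
    (hx : x ∈ s.interior) : ‖x‖ ≤ 1 := by
  obtain ⟨w, hw, hw01, rfl⟩ := hx
  rw [Finset.affineCombination_eq_linear_combination _ _ _ hw, ← hw]
  refine (norm_sum_le _ _).trans (Finset.sum_le_sum fun i _ => ?_)
  rw [norm_smul, hs.norm_points, mul_one, Real.norm_of_nonneg (hw01 i).1.le]

theorem smul_mem_interior (hs : IsStandardSimplex s) {x : EuclideanSpace ℝ (Fin n)}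
    (hx : x ∈ s.interior) {t : ℝ} (ht : t ∈ Set.Ioc (0 : ℝ) 1) : t • x ∈ s.interior := by
  obtain ⟨w, hw, hw01, rfl⟩ := hx
  have hn : (0 : ℝ) < n + 1 := by positivity
  have hn1 : ((n : ℝ) + 1)⁻¹ ≤ 1 := inv_le_one_of_one_le₀ (by simp)
  -- Since the barycentre is 0, tx is the convex combination of x and the barycentre with weights t
  -- and 1 - t.
  have hsum : ∑ i, (t * w i + (1 - t) * ((n : ℝ) + 1)⁻¹) = 1 := by
    rw [Finset.sum_add_distrib, ← Finset.mul_sum, hw]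
    simp only [Finset.sum_const, Finset.card_univ, Fintype.card_fin, nsmul_eq_mul]
    push_cast
    field_simp
    ring
  refine ⟨_, hsum, fun i => ⟨?_, ?_⟩, ?_⟩
  · exact add_pos_of_pos_of_nonneg (mul_pos ht.1 (hw01 i).1)
      (mul_nonneg (sub_nonneg.2 ht.2) (inv_nonneg.2 hn.le))
  · have h1 := mul_lt_mul_of_pos_left (hw01 i).2 ht.1
    have h2 := mul_le_mul_of_nonneg_left hn1 (sub_nonneg.2 ht.2)
    linarith
  · rw [Finset.affineCombination_eq_linear_combination _ _ _ hsum,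
      Finset.affineCombination_eq_linear_combination _ _ _ hw]
    simp only [add_smul, mul_smul, Finset.sum_add_distrib, ← Finset.smul_sum,
      hs.sum_points_eq_zero, smul_zero, add_zero]

end IsStandardSimplex

/-- The constant obtained from Jensen's inequality is at most the stated one. -/
theorem rpow_neg_le_homotopy_constant {n k : ℕ} (hk : 2 ≤ k) (hkn : k ≤ n) {p q : ℝ} (hp : 0 < p)
    (hq : 0 < q) :
    q ^ (-(1 / p)) ≤ Real.sqrt (n.choose k) * ((n : ℝ) - k + 1) / ((n : ℝ) ^ 2 * q ^ (1 / p)) *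
      (((n.factorial : ℝ) ^ ((p + 1) / p)) / ((n + 1 - k).factorial : ℝ)) ^ 2 := by
  have hn : (0 : ℝ) < n := Nat.cast_pos.2 (by omega)
  have hchoose : 1 ≤ Real.sqrt (n.choose k) :=
    Real.one_le_sqrt.2 (by exact_mod_cast Nat.choose_pos hkn)
  have hnk : (1 : ℝ) ≤ (n : ℝ) - k + 1 := by
    have : (k : ℝ) ≤ n := Nat.cast_le.2 hkn
    linarith
  have hfac : (1 : ℝ) ≤ n.factorial := by exact_mod_cast n.factorial_pos
  have hm : (0 : ℝ) < ((n + 1 - k).factorial : ℝ) := by positivity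
  -- Since k ≥ 2, (n+1-k)! ≤ (n-1)!; squaring this bound cancels the n² in the denominator.
  have hquot : (n : ℝ) ≤ (n.factorial : ℝ) ^ ((p + 1) / p) / ((n + 1 - k).factorial : ℝ) := by
    rw [le_div_iff₀ hm]
    calc (n : ℝ) * ((n + 1 - k).factorial : ℝ) ≤ n * ((n - 1).factorial : ℝ) :=
          mul_le_mul_of_nonneg_left (Nat.cast_le.2 (Nat.factorial_le (by omega))) hn.le
      _ = n.factorial := by exact_mod_cast Nat.mul_factorial_pred (by omega)
      _ ≤ (n.factorial : ℝ) ^ ((p + 1) / p) :=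
          Real.self_le_rpow_of_one_le hfac (by rw [le_div_iff₀ hp]; linarith)
  have hq' : 0 < q ^ (1 / p) := Real.rpow_pos_of_pos hq _
  rw [Real.rpow_neg hq.le, inv_eq_one_div, div_mul_eq_mul_div,
    div_le_div_iff₀ hq' (by positivity), one_mul]
  refine mul_le_mul_of_nonneg_right ?_ hq'.le
  calc (n : ℝ) ^ 2 = 1 * 1 * (n : ℝ) ^ 2 := by ring
    _ ≤ _ := by gcongr

/-! ### Dilations and averages along rays -/

section Dilation

open Measure

variable {n : ℕ} {D : Set (EuclideanSpace ℝ (Fin n))}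

theorem map_smul_restrict_le {t : ℝ} (ht : 0 < t) (hD : ∀ x ∈ D, t • x ∈ D) :
    Measure.map (fun x => t • x) (volume.restrict D) ≤
      ENNReal.ofReal ((t ^ n)⁻¹) • volume.restrict D := by
  have hm : Measurable fun x : EuclideanSpace ℝ (Fin n) => t • x := measurable_const_smul t
  refine Measure.le_iff.2 fun A hA => ?_
  rw [Measure.map_apply hm hA, Measure.restrict_apply (hm hA), Measure.smul_apply,
    Measure.restrict_apply hA]
  have hsub : (fun x => t • x) ⁻¹' A ∩ D ⊆ (fun x => t • x) ⁻¹' (A ∩ D) :=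
    fun x hx => ⟨hx.1, hD x hx.2⟩
  refine (measure_mono hsub).trans (le_of_eq ?_)
  rw [Measure.addHaar_preimage_smul _ ht.ne', abs_of_pos (by positivity), smul_eq_mul]
  simp

theorem quasiMeasurePreserving_smul_restrict {t : ℝ} (ht : 0 < t) (hD : ∀ x ∈ D, t • x ∈ D) :
    QuasiMeasurePreserving (fun x => t • x) (volume.restrict D) (volume.restrict D) :=
  ⟨measurable_const_smul t,
    (Measure.absolutelyContinuous_of_le (map_smul_restrict_le ht hD)).trans
      Measure.smul_absolutelyContinuous⟩

/-- Pullbacks of null sets being null is what makes ω(tx) jointly measurable and Sω independent of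
the representative. -/
theorem quasiMeasurePreserving_smul_prod (hD : ∀ x ∈ D, ∀ t ∈ Set.Ioc (0 : ℝ) 1, t • x ∈ D) :
    QuasiMeasurePreserving (fun z : EuclideanSpace ℝ (Fin n) × ℝ => z.2 • z.1)
      ((volume.restrict D).prod (volume.restrict (Set.Ioc (0 : ℝ) 1))) (volume.restrict D) := by
  refine QuasiMeasurePreserving.prod_of_left (by fun_prop) ?_
  filter_upwards [ae_restrict_mem measurableSet_Ioc] with t ht
  exact quasiMeasurePreserving_smul_restrict ht.1 fun x hx => hD x hx t ht

theorem lintegral_comp_smul_restrict_le {t : ℝ} (ht : 0 < t) (hD : ∀ x ∈ D, t • x ∈ D)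
    {g : EuclideanSpace ℝ (Fin n) → ℝ≥0∞} (hg : AEMeasurable g (volume.restrict D)) :
    ∫⁻ x in D, g (t • x) ≤ ENNReal.ofReal ((t ^ n)⁻¹) * ∫⁻ x in D, g x := by
  have hq := quasiMeasurePreserving_smul_restrict ht hD
  rw [← lintegral_map' (f := g) (g := fun x => t • x)
    (hg.mono_ac hq.absolutelyContinuous) hq.measurable.aemeasurable,
    ← smul_eq_mul, ← lintegral_smul_measure]
  exact lintegral_mono' (map_smul_restrict_le ht hD) le_rfl

theorem lintegral_Ioc_rpow {r : ℝ} (hr : -1 < r) :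
    ∫⁻ t in Set.Ioc (0 : ℝ) 1, ENNReal.ofReal (t ^ r) = ENNReal.ofReal (1 / (r + 1)) := by
  have hi : IntervalIntegrable (fun t : ℝ => t ^ r) volume 0 1 :=
    intervalIntegral.intervalIntegrable_rpow' hr
  rw [← ofReal_integral_eq_lintegral_ofReal, ← intervalIntegral.integral_of_le zero_le_one,
    integral_rpow (Or.inl hr)]
  · rw [Real.one_rpow, Real.zero_rpow (by linarith), sub_zero]
  · exact (intervalIntegrable_iff_integrableOn_Ioc_of_le zero_le_one).1 hi
  · filter_upwards [ae_restrict_mem measurableSet_Ioc] with t ht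
    exact Real.rpow_nonneg ht.1.le r

theorem rpow_lintegral_le_lintegral_rpow {α : Type*} [MeasurableSpace α] {μ : Measure α}
    [IsProbabilityMeasure μ] {p : ℝ} (hp : 1 ≤ p) {f : α → ℝ≥0∞} (hf : AEMeasurable f μ) :
    (∫⁻ a, f a ∂μ) ^ p ≤ ∫⁻ a, f a ^ p ∂μ := by
  have hp0 : 0 < p := by linarith
  have h := eLpNorm_le_eLpNorm_of_exponent_le (μ := μ) (p := 1) (q := ENNReal.ofReal p)
    (by simpa using ENNReal.ofReal_le_ofReal hp) hf.aestronglyMeasurable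
  rw [eLpNorm_one_eq_lintegral_enorm, eLpNorm_eq_lintegral_rpow_enorm_toReal (by simpa using hp0)
    ENNReal.ofReal_ne_top, ENNReal.toReal_ofReal hp0.le] at h
  simpa [← ENNReal.rpow_mul, hp0.ne'] using ENNReal.rpow_le_rpow h hp0.le

theorem aemeasurable_pow_mul_comp_smul
    (hD : ∀ x ∈ D, ∀ t ∈ Set.Ioc (0 : ℝ) 1, t • x ∈ D) (m : ℕ)
    {g : EuclideanSpace ℝ (Fin n) → ℝ≥0∞} (hg : AEMeasurable g (volume.restrict D)) :
    AEMeasurable (fun z : EuclideanSpace ℝ (Fin n) × ℝ =>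
      ENNReal.ofReal (z.2 ^ m) * g (z.2 • z.1))
      ((volume.restrict D).prod (volume.restrict (Set.Ioc (0 : ℝ) 1))) :=
  AEMeasurable.mul (by fun_prop)
    (hg.comp_quasiMeasurePreserving (quasiMeasurePreserving_smul_prod hD))

/-- Averaging a function along the rays of a star-shaped set is bounded on `L^p`. -/
theorem lintegral_rpow_lintegral_smul_le
    (hD : ∀ x ∈ D, ∀ t ∈ Set.Ioc (0 : ℝ) 1, t • x ∈ D)
    {p : ℝ} (hp : 1 ≤ p) {m : ℕ} (hq : 0 < p * m - n + 1)
    {g : EuclideanSpace ℝ (Fin n) → ℝ≥0∞} (hg : AEMeasurable g (volume.restrict D)) :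
    ∫⁻ x in D, (∫⁻ t in Set.Ioc (0 : ℝ) 1, ENNReal.ofReal (t ^ m) * g (t • x)) ^ p ≤
      ENNReal.ofReal (1 / (p * m - n + 1)) * ∫⁻ x in D, g x ^ p := by
  have hp0 : 0 ≤ p := by linarith
  have : IsProbabilityMeasure (volume.restrict (Set.Ioc (0 : ℝ) 1)) := ⟨by simp⟩
  have hjoint := aemeasurable_pow_mul_comp_smul hD m hg
  calc ∫⁻ x in D, (∫⁻ t in Set.Ioc (0 : ℝ) 1, ENNReal.ofReal (t ^ m) * g (t • x)) ^ p
      ≤ ∫⁻ x in D, ∫⁻ t in Set.Ioc (0 : ℝ) 1, (ENNReal.ofReal (t ^ m) * g (t • x)) ^ p := by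
        refine lintegral_mono_ae ?_
        filter_upwards [hjoint.aestronglyMeasurable.prodMk_left] with x hx
        exact rpow_lintegral_le_lintegral_rpow hp hx.aemeasurable
    _ = ∫⁻ t in Set.Ioc (0 : ℝ) 1, ∫⁻ x in D, (ENNReal.ofReal (t ^ m) * g (t • x)) ^ p :=
        lintegral_lintegral_swap (hjoint.pow_const p)
    -- The factor t^(pm) comes from the weight, t^(-n) from the Jacobian of the dilation.
    _ ≤ ∫⁻ t in Set.Ioc (0 : ℝ) 1, ENNReal.ofReal (t ^ (p * m - n)) * ∫⁻ x in D, g x ^ p := by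
        refine setLIntegral_mono' measurableSet_Ioc fun t ht => ?_
        simp_rw [ENNReal.mul_rpow_of_nonneg _ _ hp0]
        rw [lintegral_const_mul' _ _ (by finiteness)]
        refine (mul_le_mul_right (lintegral_comp_smul_restrict_le ht.1
          (fun x hx => hD x hx t ht) (hg.pow_const p)) _).trans (le_of_eq ?_)
        have ht0 := ht.1
        rw [← mul_assoc, ENNReal.ofReal_rpow_of_nonneg (by positivity) hp0,
          ← ENNReal.ofReal_mul (by positivity), Real.rpow_sub ht0, mul_comm p,
          Real.rpow_mul ht0.le, Real.rpow_natCast, Real.rpow_natCast, div_eq_mul_inv]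
    _ = _ := by
        rw [lintegral_mul_const'' _ (by fun_prop), lintegral_Ioc_rpow (by linarith)]

end Dilation

/-! ### Length as a norm on the finite-dimensional space of forms -/

namespace ExtForm

variable {n k : ℕ}

/-- The coefficients of an exterior form, as a vector whose Euclidean norm is the length. -/
noncomputable def coeffCLM (n k : ℕ) :
    ExtForm n k →L[ℝ] EuclideanSpace ℝ (Fin k ↪o Fin n) :=
  (EuclideanSpace.equiv (Fin k ↪o Fin n) ℝ).symm.toContinuousLinearMap ∘L
    ContinuousLinearMap.pi fun J =>
      ContinuousAlternatingMap.apply ℝ (EuclideanSpace ℝ (Fin n)) ℝ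
        fun i => EuclideanSpace.basisFun (Fin n) ℝ (J i)

theorem norm_coeffCLM (α : ExtForm n k) : ‖coeffCLM n k α‖ = α.length := by
  rw [EuclideanSpace.norm_eq]
  simp only [Real.norm_eq_abs, sq_abs]
  rfl

theorem enorm_length (α : ExtForm n k) : ‖α.length‖ₑ = ‖coeffCLM n k α‖ₑ := by
  rw [← norm_coeffCLM, enorm_norm]

theorem eq_zero_of_length_eq_zero {α : ExtForm n k} (h : α.length = 0) : α = 0 := by
  have hsum := α.length_sq_eq_sum (EuclideanSpace.basisFun (Fin n) ℝ)
  have hk := α.sum_sq_apply_comp (EuclideanSpace.basisFun (Fin n) ℝ)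
  rw [← hsum, h, zero_pow two_ne_zero, mul_zero,
    Finset.sum_eq_zero_iff_of_nonneg fun _ _ => sq_nonneg _] at hk
  refine ContinuousAlternatingMap.toAlternatingMap_injective
    (Module.Basis.ext_alternating (EuclideanSpace.basisFun (Fin n) ℝ).toBasis fun f _ => ?_)
  have := pow_eq_zero_iff two_ne_zero |>.1 (hk f (Finset.mem_univ f))
  simpa [Function.comp_def] using this

theorem eq_zero_of_lt (h : n < k) (α : ExtForm n k) : α = 0 := by
  have : IsEmpty (Fin k ↪o Fin n) :=
    ⟨fun J => by simpa [h.not_ge] using Fintype.card_le_of_embedding J.toEmbedding⟩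
  exact eq_zero_of_length_eq_zero (by simp [length])

theorem coeffCLM_injective : Function.Injective (coeffCLM n k) :=
  (injective_iff_map_eq_zero _).2 fun α hα =>
    eq_zero_of_length_eq_zero (by rw [← norm_coeffCLM, hα, norm_zero])

/-- Bochner integrability is stated in the operator norm while the estimates control the length; any
comparison constant suffices. -/
theorem exists_norm_le_mul_length (n k : ℕ) :
    ∃ K : ℝ, ∀ α : ExtForm n k, ‖α‖ ≤ K * α.length := by
  have : FiniteDimensional ℝ (ExtForm n k) :=
    Module.Finite.of_injective (coeffCLM n k).toLinearMap coeffCLM_injective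
  obtain ⟨K, -, hK⟩ := (coeffCLM n k).toLinearMap.exists_antilipschitzWith
    (LinearMap.ker_eq_bot.2 coeffCLM_injective)
  refine ⟨K, fun α => ?_⟩
  simpa [norm_coeffCLM] using hK.le_mul_dist α 0

theorem continuous_length : Continuous (length : ExtForm n k → ℝ) := by
  have : (length : ExtForm n k → ℝ) = fun α => ‖coeffCLM n k α‖ :=
    funext fun α => (norm_coeffCLM α).symm
  rw [this]
  fun_prop

theorem length_smul (r : ℝ) (α : ExtForm n k) : (r • α).length = |r| * α.length := by
  rw [← norm_coeffCLM, ← norm_coeffCLM, map_smul, norm_smul, Real.norm_eq_abs]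

theorem continuous_contract :
    Continuous fun z : EuclideanSpace ℝ (Fin n) × ExtForm n k => contract z.1 z.2 := by
  rcases k with _ | k
  · exact continuous_const
  · exact (ContinuousAlternatingMap.curryLeftLI.continuous.comp continuous_snd).clm_apply
      continuous_fst

end ExtForm

/-! ### The homotopy operator on star-shaped domains -/

section HomotopyOperator

variable {n k : ℕ} {D : Set (EuclideanSpace ℝ (Fin n))}
  {ω : EuclideanSpace ℝ (Fin n) → ExtForm n k}

theorem ExtForm.contract_zero (x : EuclideanSpace ℝ (Fin n)) :
    ExtForm.contract x (0 : ExtForm n k) = 0 := by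
  rcases k with _ | k
  · rfl
  · simp [ExtForm.contract]

theorem homotopyIntegrand_eq_zero_of_lt (h : n < k) (x : EuclideanSpace ℝ (Fin n)) (t : ℝ) :
    homotopyIntegrand ω x t = 0 := by
  rw [homotopyIntegrand, ExtForm.eq_zero_of_lt h (ω (t • x)), ExtForm.contract_zero, smul_zero]

theorem homotopyOp_eq_zero_of_lt (h : n < k) : homotopyOp ω = 0 := by
  ext1 x
  simp [homotopyOp, homotopyIntegrand_eq_zero_of_lt h]

theorem enorm_length_homotopyIntegrand_le {x : EuclideanSpace ℝ (Fin n)} (hx : ‖x‖ ≤ 1) {t : ℝ}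
    (ht : 0 < t) :
    ‖(homotopyIntegrand ω x t).length‖ₑ ≤
      ENNReal.ofReal (t ^ (k - 1)) * ‖(ω (t • x)).length‖ₑ := by
  have htk : 0 ≤ t ^ (k - 1) := by positivity
  rw [Real.enorm_of_nonneg (ExtForm.length_nonneg _),
    Real.enorm_of_nonneg (ExtForm.length_nonneg _), ← ENNReal.ofReal_mul htk, homotopyIntegrand,
    ExtForm.length_smul, abs_of_nonneg htk]
  exact ENNReal.ofReal_le_ofReal <| mul_le_mul_of_nonneg_left
    ((ExtForm.length_contract_le _ _).trans
      (mul_le_of_le_one_left (ExtForm.length_nonneg _) hx)) htk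

theorem aestronglyMeasurable_homotopyIntegrand
    (hD : ∀ x ∈ D, ∀ t ∈ Set.Ioc (0 : ℝ) 1, t • x ∈ D)
    (hω : AEStronglyMeasurable ω (volume.restrict D)) :
    AEStronglyMeasurable (fun z : EuclideanSpace ℝ (Fin n) × ℝ => homotopyIntegrand ω z.1 z.2)
      ((volume.restrict D).prod (volume.restrict (Set.Ioc (0 : ℝ) 1))) := by
  have h1 : AEStronglyMeasurable (fun z : EuclideanSpace ℝ (Fin n) × ℝ => ω (z.2 • z.1))
      ((volume.restrict D).prod (volume.restrict (Set.Ioc (0 : ℝ) 1))) :=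
    hω.comp_quasiMeasurePreserving (quasiMeasurePreserving_smul_prod hD)
  have h2 : AEStronglyMeasurable (fun z : EuclideanSpace ℝ (Fin n) × ℝ => z.1)
      ((volume.restrict D).prod (volume.restrict (Set.Ioc (0 : ℝ) 1))) :=
    continuous_fst.aestronglyMeasurable
  have h3 : AEStronglyMeasurable (fun z : EuclideanSpace ℝ (Fin n) × ℝ => z.2 ^ (k - 1))
      ((volume.restrict D).prod (volume.restrict (Set.Ioc (0 : ℝ) 1))) :=
    (continuous_snd.pow _).aestronglyMeasurable
  exact h3.smul (ExtForm.continuous_contract.comp_aestronglyMeasurable (h2.prodMk h1))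

theorem aestronglyMeasurable_homotopyOp
    (hD : ∀ x ∈ D, ∀ t ∈ Set.Ioc (0 : ℝ) 1, t • x ∈ D)
    (hω : AEStronglyMeasurable ω (volume.restrict D)) :
    AEStronglyMeasurable (homotopyOp ω) (volume.restrict D) := by
  have h : homotopyOp ω = fun x => ∫ t in Set.Ioc (0 : ℝ) 1, homotopyIntegrand ω x t :=
    funext fun x => intervalIntegral.integral_of_le zero_le_one
  rw [h]
  exact (aestronglyMeasurable_homotopyIntegrand hD hω).integral_prod_right'

/-- The homotopy operator respects equality almost everywhere. -/
theorem homotopyOp_congr_ae (hD : ∀ x ∈ D, ∀ t ∈ Set.Ioc (0 : ℝ) 1, t • x ∈ D)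
    {ω' : EuclideanSpace ℝ (Fin n) → ExtForm n k} (h : ω' =ᵐ[volume.restrict D] ω) :
    homotopyOp ω' =ᵐ[volume.restrict D] homotopyOp ω := by
  filter_upwards [Measure.ae_ae_of_ae_prod ((quasiMeasurePreserving_smul_prod hD).ae h)] with x hx
  rw [homotopyOp, homotopyOp, intervalIntegral.integral_of_le zero_le_one,
    intervalIntegral.integral_of_le zero_le_one]
  refine integral_congr_ae ?_
  filter_upwards [hx] with t ht
  rw [homotopyIntegrand, homotopyIntegrand, ht]

theorem intervalIntegrable_homotopyIntegrand {x : EuclideanSpace ℝ (Fin n)} (hx : ‖x‖ ≤ 1)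
    (hm : AEStronglyMeasurable (homotopyIntegrand ω x) (volume.restrict (Set.Ioc (0 : ℝ) 1)))
    (hfin : ∫⁻ t in Set.Ioc (0 : ℝ) 1,
      ENNReal.ofReal (t ^ (k - 1)) * ‖(ω (t • x)).length‖ₑ < ∞) :
    IntervalIntegrable (homotopyIntegrand ω x) volume 0 1 := by
  rw [intervalIntegrable_iff_integrableOn_Ioc_of_le zero_le_one]
  refine ⟨hm, ?_⟩
  obtain ⟨K, hK⟩ := ExtForm.exists_norm_le_mul_length n (k - 1)
  have hle : ∀ t ∈ Set.Ioc (0 : ℝ) 1, ‖homotopyIntegrand ω x t‖ₑ ≤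
      ‖K‖ₑ * (ENNReal.ofReal (t ^ (k - 1)) * ‖(ω (t • x)).length‖ₑ) := fun t ht => by
    refine le_trans ?_ (mul_le_mul_right (enorm_length_homotopyIntegrand_le hx ht.1) _)
    rw [← enorm_mul, enorm_le_iff_norm_le]
    exact (hK _).trans (le_abs_self _)
  refine (setLIntegral_mono' measurableSet_Ioc hle).trans_lt ?_
  rw [lintegral_const_mul' _ _ enorm_ne_top]
  exact ENNReal.mul_lt_top enorm_lt_top hfin

theorem enorm_length_homotopyOp_le {x : EuclideanSpace ℝ (Fin n)} (hx : ‖x‖ ≤ 1)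
    (hi : IntervalIntegrable (homotopyIntegrand ω x) volume 0 1) :
    ‖(homotopyOp ω x).length‖ₑ ≤ ∫⁻ t in Set.Ioc (0 : ℝ) 1,
      ENNReal.ofReal (t ^ (k - 1)) * ‖(ω (t • x)).length‖ₑ := by
  rw [intervalIntegrable_iff_integrableOn_Ioc_of_le zero_le_one] at hi
  -- Passing to the coefficient vector turns the length into a genuine norm, so the triangle
  -- inequality for integrals applies without loss.
  rw [ExtForm.enorm_length, homotopyOp, intervalIntegral.integral_of_le zero_le_one,
    ← ContinuousLinearMap.integral_comp_comm _ hi]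
  refine (enorm_integral_le_lintegral_enorm _).trans
    (setLIntegral_mono' measurableSet_Ioc fun t ht => ?_)
  rw [← ExtForm.enorm_length]
  exact enorm_length_homotopyIntegrand_le hx ht.1

theorem formLpNorm_rpow {p : ℝ} (hp : 0 < p) :
    formLpNorm p D ω = (∫⁻ x in D, ‖(ω x).length‖ₑ ^ p) ^ (1 / p) := by
  rw [formLpNorm, eLpNorm_eq_lintegral_rpow_enorm_toReal (by simpa using hp)
    ENNReal.ofReal_ne_top, ENNReal.toReal_ofReal hp.le]

/-- The homotopy operator on a bounded star-shaped domain: absolute convergence almost everywhere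
and the `L^p` bound. -/
theorem homotopyOp_ae_intervalIntegrable_and_formLpNorm_le (hDm : MeasurableSet D)
    (hD : ∀ x ∈ D, ∀ t ∈ Set.Ioc (0 : ℝ) 1, t • x ∈ D) (hD1 : ∀ x ∈ D, ‖x‖ ≤ 1)
    {p : ℝ} (hp : 1 ≤ p) (hq : 0 < p * (k - 1 : ℕ) - n + 1) (hω : MemFormLp p D ω) :
    (∀ᵐ x ∂(volume.restrict D), IntervalIntegrable (homotopyIntegrand ω x) volume 0 1) ∧
      formLpNorm p D (homotopyOp ω) ≤
        ENNReal.ofReal ((p * (k - 1 : ℕ) - n + 1) ^ (-(1 / p))) * formLpNorm p D ω := by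
  have hp0 : 0 < p := by linarith
  have hg : AEMeasurable (fun x => ‖(ω x).length‖ₑ) (volume.restrict D) :=
    (ExtForm.continuous_length.comp_aestronglyMeasurable hω.1).enorm
  have hmain := lintegral_rpow_lintegral_smul_le hD hp hq hg
  have hgfin : ∫⁻ x in D, ‖(ω x).length‖ₑ ^ p < ∞ := by
    have h := hω.2
    rw [formLpNorm_rpow hp0] at h
    exact (ENNReal.rpow_lt_top_iff_of_pos (by positivity)).1 h
  have hint : ∀ᵐ x ∂(volume.restrict D),
      IntervalIntegrable (homotopyIntegrand ω x) volume 0 1 := by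
    -- The ray average has finite p-th power integral, hence is finite almost everywhere.
    have hfin := ae_lt_top'
      ((aemeasurable_pow_mul_comp_smul hD (k - 1) hg).lintegral_prod_right'.pow_const p)
      (hmain.trans_lt (ENNReal.mul_lt_top ENNReal.ofReal_lt_top hgfin)).ne
    filter_upwards [hfin, (aestronglyMeasurable_homotopyIntegrand hD hω.1).prodMk_left,
      ae_restrict_mem hDm] with x hx hxm hxD
    exact intervalIntegrable_homotopyIntegrand (hD1 x hxD) hxm
      ((ENNReal.rpow_lt_top_iff_of_pos hp0).1 hx)
  refine ⟨hint, ?_⟩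
  rw [formLpNorm_rpow hp0, formLpNorm_rpow hp0, Real.rpow_neg hq.le,
    ← Real.inv_rpow hq.le, ← ENNReal.ofReal_rpow_of_nonneg (by positivity) (by positivity),
    ← ENNReal.mul_rpow_of_nonneg _ _ (by positivity), inv_eq_one_div]
  refine ENNReal.rpow_le_rpow (le_trans (lintegral_mono_ae ?_) hmain) (by positivity)
  filter_upwards [hint, ae_restrict_mem hDm] with x hx hxD
  exact ENNReal.rpow_le_rpow (enorm_length_homotopyOp_le (hD1 x hxD) hx) hp0.le

end HomotopyOperator

/-! ### The estimate on the simplex -/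

theorem mainTheorem4 (n k : ℕ) (hk : 2 ≤ k) (p : ℝ)
    (hp : ((n : ℝ) - 1) / ((k : ℝ) - 1) < p)
    (s : Affine.Simplex ℝ (EuclideanSpace ℝ (Fin n)) n) (hs : IsStandardSimplex s)
    (ω : EuclideanSpace ℝ (Fin n) → ExtForm n k) (hω : MemFormLp p s.interior ω) :
    (∀ᵐ x ∂(volume.restrict s.interior),
      IntervalIntegrable (homotopyIntegrand ω x) volume 0 1) ∧
    (∀ ω' : EuclideanSpace ℝ (Fin n) → ExtForm n k,
      ω' =ᵐ[volume.restrict s.interior] ω →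
        homotopyOp ω' =ᵐ[volume.restrict s.interior] homotopyOp ω) ∧
    MemFormLp p s.interior (homotopyOp ω) ∧
    formLpNorm p s.interior (homotopyOp ω) ≤
      ENNReal.ofReal
        (Real.sqrt (n.choose k) * ((n : ℝ) - k + 1) /
            ((n : ℝ) ^ 2 * (p * ((k : ℝ) - 1) - n + 1) ^ (1 / p)) *
          (((n.factorial : ℝ) ^ ((p + 1) / p)) / ((n + 1 - k).factorial : ℝ)) ^ 2) *
        formLpNorm p s.interior ω := by
  have hD : ∀ x ∈ s.interior, ∀ t ∈ Set.Ioc (0 : ℝ) 1, t • x ∈ s.interior :=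
    fun x hx t ht => hs.smul_mem_interior hx ht
  have hmeas := aestronglyMeasurable_homotopyOp hD hω.1
  rcases lt_or_ge n k with hnk | hkn
  · have h0 : formLpNorm p s.interior (homotopyOp ω) = 0 := by
      have hl : ∀ x, (homotopyOp ω x).length = 0 := fun x => by
        simp [homotopyOp_eq_zero_of_lt hnk, ExtForm.length, ExtForm.coeff]
      simp [formLpNorm, hl]
    refine ⟨Filter.Eventually.of_forall fun x => ?_, fun ω' h => homotopyOp_congr_ae hD h,
      ⟨hmeas, by rw [h0]; exact ENNReal.zero_lt_top⟩, by rw [h0]; exact zero_le⟩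
    rw [show homotopyIntegrand ω x = 0 from
      funext fun t => homotopyIntegrand_eq_zero_of_lt hnk x t]
    exact intervalIntegrable_const
  · have hk1 : (0 : ℝ) < (k : ℝ) - 1 := by
      have : (2 : ℝ) ≤ k := by exact_mod_cast hk
      linarith
    have hkn' : (k : ℝ) ≤ n := Nat.cast_le.2 hkn
    -- For k ≤ n the threshold (n-1)/(k-1) is already at least 1.
    have hp1 : 1 ≤ p := le_trans (by rw [le_div_iff₀ hk1]; linarith) hp.le
    have hcast : ((k - 1 : ℕ) : ℝ) = (k : ℝ) - 1 := by
      rw [Nat.cast_sub (by omega), Nat.cast_one]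
    have hq : 0 < p * ((k : ℝ) - 1) - n + 1 := by
      rw [div_lt_iff₀ hk1] at hp
      linarith
    obtain ⟨hint, hle⟩ := homotopyOp_ae_intervalIntegrable_and_formLpNorm_le
      s.isOpen_interior.measurableSet hD (fun x hx => hs.norm_le_one hx) hp1
      (by rwa [hcast]) hω
    rw [hcast] at hle
    refine ⟨hint, fun ω' h => homotopyOp_congr_ae hD h,
      ⟨hmeas, hle.trans_lt (ENNReal.mul_lt_top ENNReal.ofReal_lt_top hω.2)⟩,
      hle.trans (mul_le_mul_left (ENNReal.ofReal_le_ofReal ?_) _)⟩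
    exact rpow_neg_le_homotopy_constant hk hkn (by linarith) hq
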